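/- Let $N\ge 2$ be an integer. For $a_1,\dots,a_n\in\mathbb{Z}/N\mathbb{Z}$ with $n\ge 1$ put $$M_n(a_1,\dots,a_n)=\begin{pmatrix}a_n&-1\\1&0\end{pmatrix}\begin{pmatrix}a_{n-1}&-1\\1&0\end{pmatrix}\cdots\begin{pmatrix}a_1&-1\\1&0\end{pmatrix},$$ and call $(a_1,\dots,a_n)$ a solution (of size $n$) if $M_n(a_1,\dots,a_n)=\pm\mathrm{Id}$ over $\mathbb{Z}/N\mathbb{Z}$. For tuples of sizes $n,m\ge 2$ put $$(a_1,\dots,a_n)\oplus(b_1,\dots,b_m)=(a_1+b_m,a_2,\dots,a_{n-1},a_n+b_1,b_2,\dots,b_{m-1}),$$ and write $(a_1,\dots,a_n)\sim(b_1,\dots,b_n)$ if $(b_1,\dots,b_n)$ is a circular permutation of $(a_1,\dots,a_n)$ or of $(a_n,\dots,a_1)$. A solution $c$ of size at least $3$ is reducible if $c\sim a\oplus b$ for some tuple $a$ of size at least $3$ and some solution $b$ of size at least $3$; otherwise it is irreducible. (The only solution of size less than $3$ is $(0,0)$, which is not regarded as irreducible.) For $k\in\mathbb{Z}/N\mathbb{Z}$,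 the minimal $k$-monomial solution is the solution $(k,\dots,k)$ of least size $n\ge 1$; a minimal monomial solution is a minimal $k$-monomial solution for some $k$. The integer $N$ is called monomially irreducible if all nonzero minimal monomial solutions (that is, those with $k\neq 0$) are irreducible. Let $$\Omega=\{107,163,173,277,283,317,347,523,557,563,613,653,733,773,787,877,907,997\}.$$ Then: (i) If $N$ is prime or $N\in\{4,6,8,12,24\}$, then $N$ is monomially irreducible. (ii) If $N$ is even, then $N$ is monomially irreducible if and only if $N\in\{2,4,6,8,12,24\}$. (iii) If $N$ is odd and not prime, and $N$ is monomially irreducible, then $N=\prod_{i=1}^r p_i$, where $r\ge 2$ and the $p_i$ are pairwise distinct odd primes such that for every $i$: $p_i\equiv\pm 3\pmod 5$; $p_i\equiv\pm 3\pmod 8$; and if $p_i\le 1000$ then $p_i\in\Omega$. -/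

import Mathlib

namespace MonomialIrreducibility

/-- The matrix `M_n(a_1, …, a_n)`, i.e. the product
`(a_n, -1; 1, 0) * (a_{n-1}, -1; 1, 0) * ⋯ * (a_1, -1; 1, 0)`;
an `n`-tuple is represented by a list of length `n`. -/
def contMatrix {R : Type*} [CommRing R] : List R → Matrix (Fin 2) (Fin 2) R
  | [] => 1
  | a :: l => contMatrix l * !![a, -1; 1, 0]

/-- The tuple is a solution of the equation `M_n(a_1, …, a_n) = ± Id` over `ℤ/Nℤ`. -/
def IsSolution (N : ℕ) (a : List (ZMod N)) : Prop :=
  contMatrix a = 1 ∨ contMatrix a = -1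

/-- The sum
`(a_1, …, a_n) ⊕ (b_1, …, b_m) = (a_1 + b_m, a_2, …, a_{n-1}, a_n + b_1, b_2, …, b_{m-1})`
of tuples of sizes `n, m ≥ 2` (it is only used for `n, m ≥ 3`). -/
def tupleSum {R : Type*} [CommRing R] (a b : List R) : List R :=
  [a.headD 0 + b.getLastD 0] ++ a.tail.dropLast ++ [a.getLastD 0 + b.headD 0] ++ b.tail.dropLast

/-- `b` is a circular permutation of `a` or of the reversal of `a`. -/
def TupleEquiv {R : Type*} (a b : List R) : Prop :=
  a.IsRotated b ∨ a.reverse.IsRotated b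

/-- A solution `c` of size at least `3` is reducible if it is equivalent to a sum `a ⊕ b`, where
`b` is a solution and both `a` and `b` have size at least `3`. -/
def IsReducible (N : ℕ) (c : List (ZMod N)) : Prop :=
  IsSolution N c ∧ 3 ≤ c.length ∧
    ∃ a b : List (ZMod N), IsSolution N b ∧ TupleEquiv c (tupleSum a b) ∧
      3 ≤ a.length ∧ 3 ≤ b.length

/-- A solution of size at least `3` is irreducible if it is not reducible. (For `N ≥ 2`, the only
nonempty solution of size less than `3` is `(0, 0)`, which is not regarded as irreducible.) -/
def IsIrreducible (N : ℕ) (c : List (ZMod N)) : Prop :=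
  IsSolution N c ∧ 3 ≤ c.length ∧ ¬ IsReducible N c

/-- `c` is an `(n, k)`-monomial solution: the `n`-tuple `(k, …, k)`, with `n ≥ 1`, and a solution. -/
def IsMonomialSolution (N n : ℕ) (k : ZMod N) (c : List (ZMod N)) : Prop :=
  1 ≤ n ∧ c = List.replicate n k ∧ IsSolution N c

/-- `c` is a minimal `k`-monomial solution: an `(n, k)`-monomial solution with `n` the smallest
size for which such a solution exists. -/
def IsMinimalMonomialSolutionAt (N : ℕ) (k : ZMod N) (c : List (ZMod N)) : Prop :=
  ∃ n : ℕ, IsMonomialSolution N n k c ∧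
    ∀ (m : ℕ) (d : List (ZMod N)), IsMonomialSolution N m k d → n ≤ m

/-- `c` is a minimal monomial solution, i.e. a minimal `k`-monomial solution for some `k`. -/
def IsMinimalMonomialSolution (N : ℕ) (c : List (ZMod N)) : Prop :=
  ∃ k : ZMod N, IsMinimalMonomialSolutionAt N k c

/-- `N` is monomially irreducible: all nonzero minimal monomial solutions are irreducible. -/
def MonomiallyIrreducible (N : ℕ) : Prop :=
  ∀ c : List (ZMod N), IsMinimalMonomialSolution N c → (∃ x ∈ c, x ≠ 0) → IsIrreducible N c

/-- The explicit finite set `Ω` of primes below `1000`. -/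
def Omega : Set ℕ :=
  {107, 163, 173, 277, 283, 317, 347, 523, 557, 563, 613, 653,
    733, 773, 787, 877, 907, 997}

end MonomialIrreducibility

/-!
The matrix of the constant tuple `(k, …, k)` of size `n` is the power `S ^ n` of
`S = !![k, -1; 1, 0]`, whose entries are terms of the sequence `U 0 = 0`, `U 1 = 1`,
`U (n + 2) = k * U (n + 1) - U n` (`continuantSeq`). Hence `(k, …, k)` is a solution exactly when
`U n = 0` and `U (n + 1) = ± 1`. The determinant gives `U (n + 1) ^ 2 - U (n + 2) * U n = 1`, so
for `N` prime the condition `U n = 0` alone suffices. In a decomposition `(k, …, k) = a ⊕ b` the tuple `b` is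
`(x, k, …, k, y)`, and comparing matrices shows that such a solution `b` exists exactly when the
right term of the sequence is `± 1`. So a `k`-monomial solution of size `n ≥ 3` is reducible
if and only if `U i = ± 1` for some `2 ≤ i ≤ n - 2` (`isReducible_replicate_iff`).

This criterion determines all monomially irreducible `N` (`monomiallyIrreducible_iff`): they are
the primes and `4, 6, 8, 12, 24`.

* If `N` is prime and `U i = ± 1`, then `U (i + 1) * U (i - 1) = 0`, so one of the two factors
  vanishes and gives a solution smaller than the minimal one. The values `4, 6, 8, 12, 24` are
  a finite computation.
* If `d ^ 2 ∣ N` with `d ≥ 3`, then `k = N / d` satisfies `k ^ 2 = 0` and `2 * k ≠ 0`; then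
  `U 3 = -1` while `U 1, …, U 4` are nonzero.
* If `N = A * p` with `p ≥ 5` a prime not dividing `A > 1`, take `k` congruent to `1` modulo `A`
  and to `2` modulo `p`. The sequence of `1` is `0, 1, 1, 0, -1, -1, …` and that of `2` is
  `0, 1, 2, 3, …`, so `U n = 0` forces `3 * p ∣ n`, whereas one of `U (p - 1) = -1` and
  `U (p + 1) = 1` holds, according to the class of `p` modulo `3`.
* An `N` escaping the last two constructions is a prime or a divisor of `24`.

In particular no odd composite `N` is monomially irreducible. The third assertion of the theorem,
a list of necessary conditions on such `N`, is therefore a consequence of the classification, and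
none of the congruence conditions has to be examined.
-/

namespace MonomialIrreducibility

/-! ### The linear recurrence attached to a constant tuple -/

section Sequence

variable {R : Type*} [CommRing R]

/-- The sequence `0, 1, k, k ^ 2 - 1, …` with `U (n + 2) = k * U (n + 1) - U n`. The index is
shifted by one with respect to the continuant: `U (n + 1)` is the continuant of `n` copies
of `k`. -/
def continuantSeq (k : R) : ℕ → R
  | 0 => 0
  | 1 => 1
  | n + 2 => k * continuantSeq k (n + 1) - continuantSeq k n

@[simp] lemma continuantSeq_zero (k : R) : continuantSeq k 0 = 0 := rfl

@[simp] lemma continuantSeq_one (k : R) : continuantSeq k 1 = 1 := rfl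

lemma continuantSeq_add_two (k : R) (n : ℕ) :
    continuantSeq k (n + 2) = k * continuantSeq k (n + 1) - continuantSeq k n := rfl

lemma continuantSeq_sq_sub (k : R) (n : ℕ) :
    continuantSeq k (n + 1) ^ 2 - continuantSeq k (n + 2) * continuantSeq k n = 1 := by
  induction n with
  | zero => simp
  | succ n ih =>
    rw [continuantSeq_add_two k (n + 1)]
    rw [continuantSeq_add_two k n] at ih ⊢
    linear_combination ih

lemma map_continuantSeq {R' : Type*} [CommRing R'] (f : R →+* R') (k : R) (n : ℕ) :
    f (continuantSeq k n) = continuantSeq (f k) n := by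
  induction n using Nat.twoStepInduction with
  | zero => simp
  | one => simp
  | more n h1 h2 => simp [continuantSeq_add_two, h1, h2]

lemma continuantSeq_two_eq (n : ℕ) : continuantSeq (2 : R) n = n := by
  induction n using Nat.twoStepInduction with
  | zero => simp
  | one => simp
  | more n h1 h2 =>
    rw [continuantSeq_add_two, h1, h2]
    push_cast
    ring

lemma continuantSeq_one_add_three (n : ℕ) :
    continuantSeq (1 : R) (n + 3) = -continuantSeq (1 : R) n := by
  rw [continuantSeq_add_two, continuantSeq_add_two]
  ring

lemma continuantSeq_one_add_six_mul (m r : ℕ) :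
    continuantSeq (1 : R) (r + 6 * m) = continuantSeq (1 : R) r := by
  induction m with
  | zero => rfl
  | succ m ih =>
    rw [show r + 6 * (m + 1) = r + 6 * m + 3 + 3 by ring, continuantSeq_one_add_three,
      continuantSeq_one_add_three, neg_neg, ih]

lemma three_dvd_of_continuantSeq_one_eq_zero [Nontrivial R] {n : ℕ}
    (h : continuantSeq (1 : R) n = 0) : 3 ∣ n := by
  induction n using Nat.strong_induction_on with
  | _ n ih =>
    match n with
    | 0 => exact dvd_zero 3
    | 1 => simp at h
    | 2 => simp [continuantSeq_add_two] at h
    | m + 3 =>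
      rw [continuantSeq_one_add_three, neg_eq_zero] at h
      exact (Nat.dvd_add_self_right).2 (ih m (by omega) h)

/-! ### Matrices of constant tuples -/

lemma contMatrix_append (a b : List R) :
    contMatrix (a ++ b) = contMatrix b * contMatrix a := by
  induction a with
  | nil => simp [contMatrix]
  | cons x a ih => simp [contMatrix, ih, Matrix.mul_assoc]

lemma contMatrix_replicate (k : R) (n : ℕ) :
    contMatrix (List.replicate n k) = !![k, -1; 1, 0] ^ n := by
  induction n with
  | zero => rfl
  | succ n ih => rw [List.replicate_succ, contMatrix, ih, pow_succ]

lemma contMatrix_replicate_succ (k : R) (n : ℕ) :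
    contMatrix (List.replicate (n + 1) k) =
      !![continuantSeq k (n + 2), -continuantSeq k (n + 1);
        continuantSeq k (n + 1), -continuantSeq k n] := by
  induction n with
  | zero => simp [contMatrix, continuantSeq_add_two]
  | succ n ih =>
    rw [List.replicate_succ, contMatrix, ih, continuantSeq_add_two k (n + 1)]
    ext i j
    fin_cases i <;> fin_cases j <;> simp [Matrix.mul_apply, Fin.sum_univ_two] <;>
      rw [continuantSeq_add_two] <;> ring

lemma contMatrix_cons_replicate_append (k x y : R) (n : ℕ) :
    contMatrix (x :: (List.replicate (n + 1) k ++ [y])) =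
      !![y, -1; 1, 0] * !![continuantSeq k (n + 2), -continuantSeq k (n + 1);
        continuantSeq k (n + 1), -continuantSeq k n] * !![x, -1; 1, 0] := by
  rw [contMatrix, contMatrix_append, contMatrix_replicate_succ]
  simp [contMatrix]

end Sequence

lemma isSolution_replicate_iff {N : ℕ} (k : ZMod N) (n : ℕ) :
    IsSolution N (List.replicate n k) ↔
      continuantSeq k n = 0 ∧ (continuantSeq k (n + 1) = 1 ∨ continuantSeq k (n + 1) = -1) := by
  cases n with
  | zero => simp [IsSolution, contMatrix]
  | succ n =>
    have h2 := continuantSeq_add_two k n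
    simp only [IsSolution, contMatrix_replicate_succ]
    constructor
    · rintro (h | h)
      · have h10 := congrFun (congrFun h 1) 0
        have h00 := congrFun (congrFun h 0) 0
        simp at h10 h00
        exact ⟨h10, Or.inl h00⟩
      · have h10 := congrFun (congrFun h 1) 0
        have h00 := congrFun (congrFun h 0) 0
        simp at h10 h00
        exact ⟨h10, Or.inr h00⟩
    · rintro ⟨h0, h⟩
      rw [h0, mul_zero, zero_sub] at h2
      rw [← h2, h0]
      rcases h with h | h
      · left
        rw [h]
        ext i j
        fin_cases i <;> fin_cases j <;> simp
      · right
        rw [h]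
        ext i j
        fin_cases i <;> fin_cases j <;> simp

/-! ### The reducibility criterion -/

lemma tupleEquiv_replicate_iff {R : Type*} {n : ℕ} {k : R} {l : List R} :
    TupleEquiv (List.replicate n k) l ↔ l = List.replicate n k := by
  have key : (List.replicate n k).IsRotated l ↔ l = List.replicate n k := by
    constructor
    · rintro ⟨m, rfl⟩
      exact List.rotate_replicate k n m
    · rintro rfl
      exact List.IsRotated.refl _
  simp [TupleEquiv, key]

lemma exists_eq_cons_append_singleton {α : Type*} {l : List α} (h : 2 ≤ l.length) :
    ∃ x m y, l = x :: (m ++ [y]) ∧ m.length + 2 = l.length := by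
  match l, h with
  | x :: z :: t, _ =>
    refine ⟨x, (z :: t).dropLast, (z :: t).getLast (by simp), ?_, by simp⟩
    rw [List.dropLast_append_getLast]

lemma tupleSum_cons_append {R : Type*} [CommRing R] (x y x' y' : R) (m m' : List R) :
    tupleSum (x :: (m ++ [y])) (x' :: (m' ++ [y'])) = (x + y') :: (m ++ (y + x') :: m') := by
  simp only [tupleSum, List.getLastD_cons, List.getLastD_concat, List.headD_cons, List.tail_cons,
    List.dropLast_concat]
  simp

/-- A sum `a ⊕ b` equal to a constant tuple has `b = (x, k, …, k, y)`; the last entry of the matrix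
of `b` is, up to sign, the continuant of its middle part. -/
theorem isReducible_replicate_iff {N n : ℕ} {k : ZMod N}
    (hsol : IsSolution N (List.replicate n k)) (hn : 3 ≤ n) :
    IsReducible N (List.replicate n k) ↔
      ∃ i, 2 ≤ i ∧ i + 2 ≤ n ∧ (continuantSeq k i = 1 ∨ continuantSeq k i = -1) := by
  constructor
  · rintro ⟨-, -, a, b, hb, hab, ha3, hb3⟩
    rw [tupleEquiv_replicate_iff] at hab
    obtain ⟨x, m, y, rfl, hm⟩ := exists_eq_cons_append_singleton (l := a) (by omega)
    obtain ⟨x', m', y', rfl, hm'⟩ := exists_eq_cons_append_singleton (l := b) (by omega)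
    rw [tupleSum_cons_append, List.eq_replicate_iff] at hab
    obtain ⟨hlen, hmem⟩ := hab
    have hconst : m' = List.replicate m'.length k :=
      List.eq_replicate_of_mem fun z hz => hmem z (by simp [hz])
    simp only [List.length_cons, List.length_append] at hlen ha3 hb3
    obtain ⟨j, hj⟩ : ∃ j, m'.length = j + 1 := ⟨m'.length - 1, by simp at hb3; omega⟩
    refine ⟨j + 2, by omega, by simp at ha3; omega, ?_⟩
    rw [hconst, hj, IsSolution, contMatrix_cons_replicate_append] at hb
    rcases hb with hb | hb
    · have h11 := congrFun (congrFun hb 1) 1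
      simp [Matrix.mul_apply, Fin.sum_univ_two] at h11
      exact Or.inr (by linear_combination -h11)
    · have h11 := congrFun (congrFun hb 1) 1
      simp [Matrix.mul_apply, Fin.sum_univ_two] at h11
      exact Or.inl (by linear_combination h11)
  · rintro ⟨i, hi, hin, hU⟩
    obtain ⟨j, rfl⟩ : ∃ j, i = j + 2 := ⟨i - 2, by omega⟩
    obtain ⟨l, rfl⟩ : ∃ l, n = j + l + 4 := ⟨n - (j + 4), by omega⟩
    -- The outer entries of `b` are forced by the condition that its matrix is diagonal.
    set x : ZMod N := continuantSeq k (j + 2) * continuantSeq k (j + 1) with hx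
    refine ⟨hsol, by simp, (k - x) :: (List.replicate (l + 1) k ++ [k - x]),
      x :: (List.replicate (j + 1) k ++ [x]), ?_, ?_, by simp, by simp⟩
    · have hdet := continuantSeq_sq_sub k j
      rw [IsSolution, contMatrix_cons_replicate_append, hx]
      rcases hU with hU | hU
      · right
        rw [hU] at hdet ⊢
        ext i j
        fin_cases i <;> fin_cases j <;> simp [Matrix.mul_apply, Fin.sum_univ_two]
        linear_combination -hdet
      · left
        rw [hU] at hdet ⊢
        ext i j
        fin_cases i <;> fin_cases j <;> simp [Matrix.mul_apply, Fin.sum_univ_two]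
        linear_combination hdet
    · rw [tupleEquiv_replicate_iff, tupleSum_cons_append, List.eq_replicate_iff]
      refine ⟨by simp; omega, fun z hz => ?_⟩
      simp at hz
      tauto

/-! ### Minimal monomial solutions -/

lemma exists_isSolution_replicate (N : ℕ) (hN : 2 ≤ N) (k : ZMod N) :
    ∃ n, 1 ≤ n ∧ IsSolution N (List.replicate n k) := by
  have : NeZero N := ⟨by omega⟩
  have hdet : IsUnit (!![k, -1; 1, 0] : Matrix (Fin 2) (Fin 2) (ZMod N)) := by
    rw [Matrix.isUnit_iff_isUnit_det]
    simp
  obtain ⟨u, hu⟩ := hdet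
  refine ⟨orderOf u, orderOf_pos u, Or.inl ?_⟩
  rw [contMatrix_replicate, ← hu, ← Units.val_pow_eq_pow_val, pow_orderOf_eq_one, Units.val_one]

/-- The size of the minimal `k`-monomial solution is a zero of the sequence. If all positive zeros
are at least `i + 2`, then `i` lies in the range required by `isReducible_replicate_iff`. -/
lemma not_monomiallyIrreducible_of_continuantSeq {N : ℕ} (hN : 2 ≤ N) (k : ZMod N) (hk : k ≠ 0)
    (i : ℕ) (hi : 2 ≤ i) (hU : continuantSeq k i = 1 ∨ continuantSeq k i = -1)
    (hzero : ∀ t, 1 ≤ t → continuantSeq k t = 0 → i + 2 ≤ t) :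
    ¬ MonomiallyIrreducible N := by
  classical
  intro hMI
  have hex := exists_isSolution_replicate N hN k
  obtain ⟨hn1, hsol⟩ := Nat.find_spec hex
  have hin := hzero _ hn1 ((isSolution_replicate_iff k _).1 hsol).1
  have hirr := hMI (List.replicate (Nat.find hex) k)
    ⟨k, Nat.find hex, ⟨hn1, rfl, hsol⟩, fun m d ⟨hm, hd, hds⟩ => Nat.find_min' hex ⟨hm, hd ▸ hds⟩⟩
    ⟨k, List.mem_replicate.2 ⟨by omega, rfl⟩, hk⟩
  exact hirr.2.2 ((isReducible_replicate_iff hsol (by omega)).2 ⟨i, hi, hin, hU⟩)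

lemma monomiallyIrreducible_of_continuantSeq {N : ℕ} (hN : 2 ≤ N)
    (h : ∀ (k : ZMod N) (n : ℕ), k ≠ 0 → IsSolution N (List.replicate n k) →
      (∀ m, 1 ≤ m → IsSolution N (List.replicate m k) → n ≤ m) →
      ∀ i, 2 ≤ i → i + 2 ≤ n → continuantSeq k i ≠ 1 ∧ continuantSeq k i ≠ -1) :
    MonomiallyIrreducible N := by
  have : Fact (1 < N) := ⟨hN⟩
  rintro c ⟨k, n, ⟨hn1, rfl, hsol⟩, hmin⟩ ⟨x, hx, hx0⟩
  obtain rfl := List.eq_of_mem_replicate hx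
  have hn : 3 ≤ n := by
    have h0 := ((isSolution_replicate_iff x n).1 hsol).1
    by_contra hlt
    obtain rfl | rfl : n = 1 ∨ n = 2 := by omega
    · simp at h0
    · exact hx0 (by simpa [continuantSeq_add_two] using h0)
  refine ⟨hsol, by simpa using hn, fun hred => ?_⟩
  obtain ⟨i, hi, hin, hU⟩ := (isReducible_replicate_iff hsol hn).1 hred
  have := h x n hx0 hsol (fun m hm hms => hmin m _ ⟨hm, rfl, hms⟩) i hi hin
  tauto

/-! ### The monomially irreducible values -/

theorem monomiallyIrreducible_of_prime {N : ℕ} (hp : N.Prime) : MonomiallyIrreducible N := by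
  have : Fact N.Prime := ⟨hp⟩
  refine monomiallyIrreducible_of_continuantSeq hp.two_le fun k n _ _ hmin i hi hin => ?_
  -- At a zero `t` the determinant identity gives `U (t + 1) ^ 2 = 1`, hence a solution of size `t`.
  have hne : ∀ t, 1 ≤ t → t < n → continuantSeq k t ≠ 0 := by
    intro t ht htn h0
    have hdet := continuantSeq_sq_sub k t
    rw [h0, mul_zero, sub_zero, sq_eq_one_iff] at hdet
    exact absurd (hmin t ht ((isSolution_replicate_iff k t).2 ⟨h0, hdet⟩)) (by omega)
  obtain ⟨j, rfl⟩ : ∃ j, i = j + 1 := ⟨i - 1, by omega⟩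
  rw [← not_or, ← sq_eq_one_iff]
  intro hsq
  have hdet := continuantSeq_sq_sub k j
  rw [hsq, sub_eq_self, mul_eq_zero] at hdet
  rcases hdet with h | h
  · exact hne _ (by omega) (by omega) h
  · exact hne _ (by omega) (by omega) h

/-- A finite criterion: it suffices to exhibit, for each `k`, some monomial solution, minimal or
not, below which the sequence does not take the values `± 1`. -/
lemma monomiallyIrreducible_of_forall_exists {N : ℕ} (hN : 2 ≤ N) (b : ℕ)
    (h : ∀ k : ZMod N, ∃ n < b, k = 0 ∨ 1 ≤ n ∧ continuantSeq k n = 0 ∧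
      (continuantSeq k (n + 1) = 1 ∨ continuantSeq k (n + 1) = -1) ∧
      ∀ i < n - 1, 2 ≤ i → continuantSeq k i ≠ 1 ∧ continuantSeq k i ≠ -1) :
    MonomiallyIrreducible N := by
  refine monomiallyIrreducible_of_continuantSeq hN fun k n hk _ hmin i hi hin => ?_
  obtain ⟨m, -, hm⟩ := h k
  obtain ⟨hm1, h0, h1, hm⟩ := hm.resolve_left hk
  have := hmin m hm1 ((isSolution_replicate_iff k m).2 ⟨h0, h1⟩)
  exact hm i (by omega) hi

theorem monomiallyIrreducible_of_mem {N : ℕ} (h : N ∈ ({4, 6, 8, 12, 24} : Set ℕ)) :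
    MonomiallyIrreducible N := by
  simp only [Set.mem_insert_iff, Set.mem_singleton_iff] at h
  rcases h with rfl | rfl | rfl | rfl | rfl <;>
    exact monomiallyIrreducible_of_forall_exists (by norm_num) 25 (by decide +kernel)

/-! ### Reducible minimal monomial solutions -/

theorem not_monomiallyIrreducible_of_sq_dvd {N d : ℕ} (hN : 2 ≤ N) (hd : 3 ≤ d)
    (hdN : d ^ 2 ∣ N) : ¬ MonomiallyIrreducible N := by
  obtain ⟨e, he⟩ := hdN
  have he0 : 0 < e := by
    rcases Nat.eq_zero_or_pos e with rfl | h
    · omega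
    · exact h
  have hN' : N = d * (d * e) := by rw [he]; ring
  have hde : 0 < d * e := by positivity
  have hne : ∀ a : ℕ, 0 < a → a < 3 → ((a * (d * e) : ℕ) : ZMod N) ≠ 0 := by
    intro a ha ha3 h0
    have := Nat.le_of_dvd (by positivity) ((ZMod.natCast_eq_zero_iff _ _).1 h0)
    nlinarith
  have hk : ((d * e : ℕ) : ZMod N) ≠ 0 := by simpa using hne 1 one_pos (by omega)
  have h2k := hne 2 two_pos (by omega)
  have hsq : ((d * e : ℕ) : ZMod N) * ((d * e : ℕ) : ZMod N) = 0 := by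
    rw [← Nat.cast_mul, ZMod.natCast_eq_zero_iff, he]
    exact ⟨e, by ring⟩
  rw [Nat.cast_mul 2] at h2k
  set k : ZMod N := ((d * e : ℕ) : ZMod N)
  have h2 : continuantSeq k 2 = k := by simp [continuantSeq_add_two]
  have h3 : continuantSeq k 3 = -1 := by
    rw [continuantSeq_add_two, h2, hsq]
    simp
  have h4 : continuantSeq k 4 = -(2 * k) := by
    rw [continuantSeq_add_two, h3, h2]
    ring
  have : Fact (1 < N) := ⟨hN⟩
  refine not_monomiallyIrreducible_of_continuantSeq hN k hk 3 (by omega) (Or.inr h3) ?_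
  intro t ht h0
  by_contra hlt
  obtain rfl | rfl | rfl | rfl : t = 1 ∨ t = 2 ∨ t = 3 ∨ t = 4 := by omega
  · simp at h0
  · exact hk (h2 ▸ h0)
  · rw [h3] at h0
    simp at h0
  · rw [h4, neg_eq_zero] at h0
    exact h2k (by simpa using h0)

theorem not_monomiallyIrreducible_of_coprime_mul {A p : ℕ} (hA : 2 ≤ A) (hp : p.Prime)
    (hp5 : 5 ≤ p) (hAp : A.Coprime p) : ¬ MonomiallyIrreducible (A * p) := by
  have : Fact (1 < A) := ⟨hA⟩
  let e := ZMod.chineseRemainder hAp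
  set k : ZMod (A * p) := e.symm (1, 2) with hk
  have hseq : ∀ n, e (continuantSeq k n) = (continuantSeq 1 n, (n : ZMod p)) := by
    intro n
    have h : e (continuantSeq k n) = continuantSeq ((1, 2) : ZMod A × ZMod p) n := by
      have := map_continuantSeq e.toRingHom k n
      simpa [hk] using this
    rw [h]
    refine Prod.ext ?_ ?_
    · exact map_continuantSeq (RingHom.fst (ZMod A) (ZMod p)) (1, 2) n
    · exact (map_continuantSeq (RingHom.snd (ZMod A) (ZMod p)) (1, 2) n).trans
        (continuantSeq_two_eq n)
  have hzero : ∀ t, 1 ≤ t → continuantSeq k t = 0 → 3 * p ≤ t := by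
    intro t ht h0
    have h := hseq t
    rw [h0, map_zero] at h
    have h3 : 3 ∣ t :=
      three_dvd_of_continuantSeq_one_eq_zero (R := ZMod A) (congrArg Prod.fst h).symm
    have hpt : p ∣ t := (ZMod.natCast_eq_zero_iff _ _).1 (congrArg Prod.snd h).symm
    have hcop : Nat.Coprime 3 p := (Nat.coprime_primes Nat.prime_three hp).2 (by omega)
    exact Nat.le_of_dvd ht (hcop.mul_dvd_of_dvd_of_dvd h3 hpt)
  have hk0 : k ≠ 0 := by
    intro h0
    have := hzero 2 (by omega) (by simp [continuantSeq_add_two, h0])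
    omega
  have h2 : p % 2 = 1 := Nat.odd_iff.1 (hp.odd_of_ne_two (by omega))
  have h3 : p % 3 ≠ 0 := fun h =>
    absurd ((Nat.prime_dvd_prime_iff_eq Nat.prime_three hp).1 (Nat.dvd_of_mod_eq_zero h)) (by omega)
  have hN : 2 ≤ A * p := by nlinarith
  obtain h | h : p % 6 = 1 ∨ p % 6 = 5 := by omega
  · refine not_monomiallyIrreducible_of_continuantSeq hN k hk0 (p + 1) (by omega) (Or.inl ?_)
      fun t ht h0 => le_trans (by omega) (hzero t ht h0)
    apply e.injective
    rw [hseq, map_one, show p + 1 = 2 + 6 * (p / 6) by omega, continuantSeq_one_add_six_mul,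
      show 2 + 6 * (p / 6) = p + 1 by omega]
    simp [continuantSeq_add_two]
  · refine not_monomiallyIrreducible_of_continuantSeq hN k hk0 (p - 1) (by omega) (Or.inr ?_)
      fun t ht h0 => le_trans (by omega) (hzero t ht h0)
    apply e.injective
    rw [hseq, map_neg, map_one, show p - 1 = 4 + 6 * (p / 6) by omega,
      continuantSeq_one_add_six_mul, show 4 + 6 * (p / 6) = p - 1 by omega,
      Nat.cast_sub hp.one_le]
    refine Prod.ext ?_ ?_ <;> simp [continuantSeq_add_two]

/-! ### The classification -/

/-- The primes and `4, 6, 8, 12, 24` are the only monomially irreducible integers. -/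
theorem monomiallyIrreducible_iff {N : ℕ} (hN : 2 ≤ N) :
    MonomiallyIrreducible N ↔ N.Prime ∨ N ∈ ({4, 6, 8, 12, 24} : Set ℕ) := by
  refine ⟨fun hMI => ?_, fun h => h.elim monomiallyIrreducible_of_prime
    monomiallyIrreducible_of_mem⟩
  have hsq : ∀ d, 3 ≤ d → ¬ d ^ 2 ∣ N := fun d hd hdN =>
    not_monomiallyIrreducible_of_sq_dvd hN hd hdN hMI
  by_cases hbig : ∃ p, p.Prime ∧ 5 ≤ p ∧ p ∣ N
  · obtain ⟨p, hp, hp5, A, rfl⟩ := hbig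
    left
    have hpA : ¬ p ∣ A := fun h => hsq p (by omega) (by rw [pow_two]; exact mul_dvd_mul_left p h)
    have hA0 : A ≠ 0 := by
      rintro rfl
      exact hpA (dvd_zero p)
    by_cases hA1 : A = 1
    · simpa [hA1] using hp
    · rw [mul_comm] at hMI
      exact absurd hMI (not_monomiallyIrreducible_of_coprime_mul (by omega) hp hp5
        ((Nat.Prime.coprime_iff_not_dvd hp).2 hpA).symm)
  · push Not at hbig
    have h24 : N ∣ 24 := by
      rw [Nat.dvd_iff_prime_pow_dvd_dvd]
      intro p a hp hpa
      rcases Nat.eq_zero_or_pos a with rfl | ha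
      · simp
      have hp5 : p < 5 := by
        by_contra h
        exact hbig p hp (by omega) ((dvd_pow_self p (by omega)).trans hpa)
      obtain rfl | rfl : p = 2 ∨ p = 3 := by
        have := hp.two_le
        have : p ≠ 4 := by
          rintro rfl
          revert hp
          decide
        omega
      · have ha4 : a ≤ 3 := by
          by_contra h
          exact hsq 4 (by omega) ((pow_dvd_pow 2 (by omega : 4 ≤ a)).trans hpa)
        exact (pow_dvd_pow 2 ha4).trans (by norm_num)
      · have ha2 : a ≤ 1 := by
          by_contra h
          exact hsq 3 (by omega) ((pow_dvd_pow 3 (by omega : 2 ≤ a)).trans hpa)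
        exact (pow_dvd_pow 3 ha2).trans (by norm_num)
    have hle : N ≤ 24 := Nat.le_of_dvd (by norm_num) h24
    simp only [Set.mem_insert_iff, Set.mem_singleton_iff]
    interval_cases N <;> first | omega | norm_num

end MonomialIrreducibility

theorem mainTheorem1 (N : ℕ) (hN : 2 ≤ N) :
    ((N.Prime ∨ N ∈ ({4, 6, 8, 12, 24} : Set ℕ)) →
      MonomialIrreducibility.MonomiallyIrreducible N) ∧
    (Even N →
      (MonomialIrreducibility.MonomiallyIrreducible N ↔
        N ∈ ({2, 4, 6, 8, 12, 24} : Set ℕ))) ∧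
    (Odd N → ¬ N.Prime → MonomialIrreducibility.MonomiallyIrreducible N →
      ∃ (r : ℕ) (p : Fin r → ℕ), 2 ≤ r ∧ N = ∏ i, p i ∧ Function.Injective p ∧
        (∀ i, (p i).Prime ∧ Odd (p i)) ∧
        (∀ i, (p i : ℤ) ≡ 3 [ZMOD 5] ∨ (p i : ℤ) ≡ -3 [ZMOD 5]) ∧
        (∀ i, (p i : ℤ) ≡ 3 [ZMOD 8] ∨ (p i : ℤ) ≡ -3 [ZMOD 8]) ∧
        (∀ i, p i ≤ 1000 → p i ∈ MonomialIrreducibility.Omega)) := by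
  have hiff := MonomialIrreducibility.monomiallyIrreducible_iff hN
  refine ⟨hiff.2, fun hev => ?_, fun hodd hnp hMI => ?_⟩
  · have h2 : N.Prime ↔ N = 2 := ⟨fun hp => hp.even_iff.1 hev, fun h => h ▸ Nat.prime_two⟩
    rw [hiff, h2]
    rfl
  · -- The classification leaves no odd composite `N`: the exceptional values are even.
    have hmem := (hiff.1 hMI).resolve_left hnp
    simp only [Set.mem_insert_iff, Set.mem_singleton_iff] at hmem
    rw [Nat.odd_iff] at hodd
    omega
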